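/- Fix a set $X$ of atomic concepts and a set $R$ of roles with a distinguished role $\mathtt{id}\in R$. **$\mathcal{ALC}$.** Formulas: $C ::= \top \mid A \mid C\sqcap C \mid \lnot C \mid \exists\rho.C$ ($A\in X$, $\rho\in R$), with the usual semantics in interpretations $\mathcal I=(J,c,r)$, $c:X\to\wp(J)$, $r:R\to\wp(J\times J)$. The interpretation is *functional* (an $\mathcal{ALC}_1$ interpretation) if for all $\rho\in R$ and $j\in J$ there is exactly one $k$ with $(j,k)\in r(\rho)$. **ADL.** Formulas: $\alpha ::= \top\mid\bot\mid A\mid(\alpha\,?\,\alpha:\alpha)\mid(\alpha\mid\alpha)_\rho$. An *aleatoric structure* $\mathcal B=(I,r,\ell)$ has a set $I$, for all $\rho\in R$ and $i\in I$ a (discrete) probability distribution $\rho(i,\cdot)$ on $I$, and likelihoods $\ell(i,A)\in[0,1]$. It is an *aleatoric belief model* if moreover $\mathtt{id}(i,j)>0$ implies $\mathtt{id}(j,k)=\mathtt{id}(i,k)$ for all $i,j,k\in I$. Put $\mathcal B_i(\top)=1$, $\mathcal B_i(\bot)=0$, $\mathcal B_i(A)=\ell(i,A)$, $\mathcal B_i(\alpha\,?\,\beta:\gamma)=\mathcal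 B_i(\alpha)\mathcal B_i(\beta)+(1-\mathcal B_i(\alpha))\mathcal B_i(\gamma)$ and $$\mathcal B_i((\alpha\mid\beta)_\rho)=\frac{\sum_{j}\rho(i,j)\mathcal B_j(\alpha)\mathcal B_j(\beta)}{\sum_{j}\rho(i,j)\mathcal B_j(\beta)}\ \text{ if } \sum_j\rho(i,j)\mathcal B_j(\beta)>0,\qquad \mathcal B_i((\alpha\mid\beta)_\rho)=1\ \text{ otherwise.}$$ A functional interpretation $\mathcal I$ is read as the aleatoric structure $\mathcal B^{\mathcal I}$ on the same individuals with $\ell(j,A)=1$ if $j\in c(A)$ and $0$ otherwise, and with $\rho(j,\cdot)$ concentrated on the unique $\rho$-successor of $j$. An ADL formula $\alpha'$ is *logically equivalent* to an $\mathcal{ALC}$ formula $\alpha$ if for every functional interpretation $\mathcal I$ and individual $j$: $\mathcal I_j\models\alpha$ if and only if $\mathcal B^{\mathcal I}_j(\alpha')=1$. **Samplings.** Let $\mathcal B_i$ be a pointed aleatoric belief model. Let $W_i$ be the set of words $i\,\rho_1y_1\,\rho_2y_2\cdots\rho_ny_n$ ($n\ge 0$, $\rho_k\in R$, $y_k\in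 I$), and write $\mathrm{last}(w)\in I$ for the last letter of $w$. A *sampling* of $\mathcal B_i$ is a functional interpretation with set of individuals $W_i$ such that the $\rho$-successor of each $w$ is $w\rho y$ for some $y$ with $\rho(\mathrm{last}(w),y)>0$, and $w\in c(A)$ implies $\ell(\mathrm{last}(w),A)>0$. Let $\Omega^{\mathcal B_i}$ be the set of all samplings, let $\mathcal F$ be the $\sigma$-algebra on it generated by the events "$w\in c(A)$" and "the $\rho$-successor of $w$ is $w\rho y$", and for an $\mathcal{ALC}$ formula $\beta$ let $\hat\beta\subseteq\Omega^{\mathcal B_i}$ be the set of samplings that satisfy $\beta$ at the one-letter word $i$. **Theorem.** To every $\mathcal{ALC}$ formula $\alpha$ one can assign an ADL formula $\alpha^*$, depending only on $\alpha$ and logically equivalent to $\alpha$, such that for every pointed aleatoric belief model $\mathcal B_i$ there is a probability measure $P^{\mathcal B_i}$ on $(\Omega^{\mathcal B_i},\mathcal F)$ with the following properties. 1. $P^{\mathcal B_i}$ is the law of independent rolls of all dice of $\mathcal B_i$: for all finite sets $S\subseteq W_i\times X$ and $T\subseteq W_i\times R$, all $S'\subseteq S$ and all $y:T\to I$, the probability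 that for every $(w,A)\in S$ one has $w\in c(A)$ if and only if $(w,A)\in S'$, and that for every $(w,\rho)\in T$ the $\rho$-successor of $w$ is $w\,\rho\,y(w,\rho)$, equals $$\prod_{(w,A)\in S'}\ell(\mathrm{last}(w),A)\prod_{(w,A)\in S\setminus S'}\bigl(1-\ell(\mathrm{last}(w),A)\bigr)\prod_{(w,\rho)\in T}\rho\bigl(\mathrm{last}(w),y(w,\rho)\bigr).$$ 2. $\hat\beta\in\mathcal F$ for every $\mathcal{ALC}$ formula $\beta$. 3. $P^{\mathcal B_i}(\hat\alpha)=\mathcal B_i(\alpha^*)$ for every $\mathcal{ALC}$ formula $\alpha$. -/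

import Mathlib

open MeasureTheory

/-- Concepts (formulas) of the description logic ALC over atomic concepts `X` and roles `R`. -/
inductive ALC (X R : Type*) where
  | top : ALC X R
  | atom : X → ALC X R
  | inf : ALC X R → ALC X R → ALC X R
  | neg : ALC X R → ALC X R
  | ex : R → ALC X R → ALC X R

/-- Formulas of aleatoric description logic: always, never, atomic concepts,
if-then-else `(α ? β : γ)` and marginalisation `(α | β)_ρ`. -/
inductive ADL (X R : Type*) where
  | top : ADL X R
  | bot : ADL X R
  | atom : X → ADL X R
  | ite : ADL X R → ADL X R → ADL X R → ADL X R
  | cond : ADL X R → ADL X R → R → ADL X R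

/-- Interpretations of ALC on a set `I` of individuals. -/
structure Interp (X R I : Type*) where
  c : X → Set I
  r : R → Set (I × I)

namespace Interp

variable {X R I : Type*}

/-- The satisfaction relation of ALC at an individual. -/
def Sat (M : Interp X R I) : ALC X R → I → Prop
  | .top => fun _ => True
  | .atom A => fun i => i ∈ M.c A
  | .inf C D => fun i => M.Sat C i ∧ M.Sat D i
  | .neg C => fun i => ¬ M.Sat C i
  | .ex ρ C => fun i => ∃ j, (i, j) ∈ M.r ρ ∧ M.Sat C j

/-- Functional interpretations (interpretations of ALC₁): every individual has exactly one
successor for every role. -/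
def Functional (M : Interp X R I) : Prop :=
  ∀ (ρ : R) (i : I), ∃! j, (i, j) ∈ M.r ρ

end Interp

/-- Individuals `I`, a probability distribution `role ρ i` on `I` for every role and individual,
and a likelihood `lik i A` for every individual and atomic concept. -/
structure AleatoricStructure (X R I : Type*) where
  role : R → I → PMF I
  lik : I → X → unitInterval

/-- Aleatoric belief models: aleatoric structures in which the identity role `idr` satisfies
its additional constraint. -/
structure BeliefModel (X R : Type*) (idr : R) (I : Type*) extends AleatoricStructure X R I where
  id_role : ∀ i j k : I, 0 < role idr i j → role idr j k = role idr i k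

namespace AleatoricStructure

variable {X R I : Type*}

/-- The probability `𝓑_i(α)` that individual `i` satisfies the ADL formula `α`. -/
noncomputable def eval (B : AleatoricStructure X R I) : ADL X R → I → ℝ
  | .top => fun _ => 1
  | .bot => fun _ => 0
  | .atom A => fun i => (B.lik i A : ℝ)
  | .ite α β γ => fun i => B.eval α i * B.eval β i + (1 - B.eval α i) * B.eval γ i
  | .cond α β ρ => fun i =>
      open Classical in
      if 0 < ∑' j, (B.role ρ i j).toReal * B.eval β j then
        (∑' j, (B.role ρ i j).toReal * B.eval α j * B.eval β j) /
          (∑' j, (B.role ρ i j).toReal * B.eval β j)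
      else 1

end AleatoricStructure

open Classical in
/-- A functional interpretation seen as an aleatoric structure: all probabilities are `0` or `1`,
and the distribution of `ρ` at `i` is concentrated on the unique `ρ`-successor of `i`. -/
noncomputable def Interp.toAleatoric {X R I : Type*} (M : Interp X R I) (hM : M.Functional) :
    AleatoricStructure X R I where
  role ρ i := PMF.pure (hM ρ i).choose
  lik i A := if i ∈ M.c A then 1 else 0

/-- The words `i ρ₁ y₁ ρ₂ y₂ … ρₙ yₙ` with a fixed first letter `i`. The one-letter word `i` is
`start`, and `step w ρ y` is the word `w ρ y`. -/
inductive SampleWord (R I : Type*) where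
  | start : SampleWord R I
  | step : SampleWord R I → R → I → SampleWord R I

/-- The last letter of a word with first letter `i`. -/
def SampleWord.last {R I : Type*} (i : I) : SampleWord R I → I
  | .start => i
  | .step _ _ y => y

namespace AleatoricStructure

variable {X R I : Type*}

/-- Samplings of the pointed structure `𝓑_i`: functional interpretations on the words with first
letter `i`, where the `ρ`-successor of a word `w` with last letter `x` is `w ρ y` for some `y`
with `ρ(x,y) > 0`, and `w` satisfies only atomic concepts `A` with `ℓ(x,A) > 0`. -/
structure IsSampling (B : AleatoricStructure X R I) (i : I)
    (M : Interp X R (SampleWord R I)) : Prop where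
  functional : M.Functional
  role_succ : ∀ ρ w w', (w, w') ∈ M.r ρ → ∃ y, w' = w.step ρ y ∧ 0 < B.role ρ (w.last i) y
  concept : ∀ A w, w ∈ M.c A → 0 < (B.lik (w.last i) A : ℝ)

/-- The sample space `Ω` of the pointed structure `𝓑_i`. -/
def Sampling (B : AleatoricStructure X R I) (i : I) : Type _ :=
  {M : Interp X R (SampleWord R I) // B.IsSampling i M}

/-- The σ-algebra on `Ω` generated by the outcomes of the individual dice: whether the word `w`
satisfies `A`, and whether the `ρ`-successor of `w` is `w ρ y`. -/
instance samplingSigmaAlgebra (B : AleatoricStructure X R I) (i : I) :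
    MeasurableSpace (B.Sampling i) :=
  MeasurableSpace.generateFrom
    ({S | ∃ (w : SampleWord R I) (A : X), S = {M | w ∈ M.1.c A}} ∪
     {S | ∃ (w : SampleWord R I) (ρ : R) (y : I), S = {M | (w, w.step ρ y) ∈ M.1.r ρ}})

/-- The event `β̂`: the samplings that satisfy `β` at their initial individual. -/
def hat (B : AleatoricStructure X R I) (i : I) (β : ALC X R) : Set (B.Sampling i) :=
  {M | M.1.Sat β .start}

/-- The samplings in which finitely many dice have prescribed outcomes: for `(w, A)` in `s`, the
truth value of `A` at `w` is `b (w, A)`, and for `(w, ρ)` in `t`, the `ρ`-successor of `w` is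
`w ρ y(w, ρ)`. -/
def cylinder (B : AleatoricStructure X R I) (i : I)
    (s : Finset (SampleWord R I × X)) (b : SampleWord R I × X → Bool)
    (t : Finset (SampleWord R I × R)) (y : SampleWord R I × R → I) : Set (B.Sampling i) :=
  {M | (∀ d ∈ s, (d.1 ∈ M.1.c d.2 ↔ b d = true)) ∧
       (∀ d ∈ t, (d.1, d.1.step d.2 (y d)) ∈ M.1.r d.2)}

/-- `P` is the law of a sampling of `𝓑_i`: all dice are rolled independently, at a word with last
letter `x` the die of the atomic concept `A` shows `true` with probability `ℓ(x,A)`, and the die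
of the role `ρ` shows `y` with probability `ρ(x,y)`. -/
def IsSamplingLaw (B : AleatoricStructure X R I) (i : I) (P : Measure (B.Sampling i)) : Prop :=
  ∀ (s : Finset (SampleWord R I × X)) (b : SampleWord R I × X → Bool)
    (t : Finset (SampleWord R I × R)) (y : SampleWord R I × R → I),
    P.real (B.cylinder i s b t y) =
      (∏ d ∈ s, if b d then (B.lik (d.1.last i) d.2 : ℝ) else 1 - B.lik (d.1.last i) d.2) *
      ∏ d ∈ t, (B.role d.2 (d.1.last i) (y d)).toReal

end AleatoricStructure

open ProbabilityTheory

namespace ALC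

variable {X R : Type*}

/-- Modal depth. -/
def depth : ALC X R → ℕ
  | .top => 0
  | .atom _ => 0
  | .inf C D => max C.depth D.depth
  | .neg C => C.depth
  | .ex _ C => C.depth + 1

/-- The always false concept. -/
def bot : ALC X R := .neg .top

/-- Disjunction. -/
def or (C D : ALC X R) : ALC X R := .neg (.inf (.neg C) (.neg D))

/-- The maximal subformulas that are atomic or existential. -/
def base : ALC X R → List (ALC X R)
  | .top => []
  | .atom A => [.atom A]
  | .inf C D => C.base ++ D.base
  | .neg C => C.base
  | .ex ρ C => [.ex ρ C]

/-- The atomic concept or role that governs an atomic or existential formula. -/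
def head : ALC X R → Option (X ⊕ R)
  | .atom A => some (.inl A)
  | .ex ρ _ => some (.inr ρ)
  | _ => none

/-- The argument of an existential formula. -/
def arg : ALC X R → Option (ALC X R)
  | .ex _ C => some C
  | _ => none

/-- Truth of a formula under a propositional valuation of its base. -/
def Holds (V : ALC X R → Prop) : ALC X R → Prop
  | .top => True
  | .atom A => V (.atom A)
  | .inf C D => C.Holds V ∧ D.Holds V
  | .neg C => ¬ C.Holds V
  | .ex ρ C => V (.ex ρ C)

/-- The atomic concepts and roles governing the base of a formula. -/
noncomputable def letters (α : ALC X R) : List (X ⊕ R) :=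
  open Classical in (α.base.filterMap head).dedup

/-- The arguments of the existential formulas in the base of a formula. -/
def args (α : ALC X R) : List (ALC X R) := α.base.filterMap arg

theorem holds_congr {V V' : ALC X R → Prop} (α : ALC X R) (h : ∀ φ ∈ α.base, V φ ↔ V' φ) :
    α.Holds V ↔ α.Holds V' := by
  induction α with
  | top => rfl
  | atom A => exact h _ (by simp [base])
  | inf C D hC hD =>
    exact and_congr (hC fun φ hφ => h φ (by simp [base, hφ]))
      (hD fun φ hφ => h φ (by simp [base, hφ]))
  | neg C hC => exact not_congr (hC h)
  | ex ρ C => exact h _ (by simp [base])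

theorem holds_sat {W : Type*} (M : Interp X R W) (w : W) (α : ALC X R) :
    α.Holds (fun φ => M.Sat φ w) ↔ M.Sat α w := by
  induction α with
  | inf C D hC hD => exact and_congr hC hD
  | neg C hC => exact not_congr hC
  | _ => rfl

theorem exists_head_of_mem_base {α φ : ALC X R} (h : φ ∈ α.base) : ∃ l, φ.head = some l := by
  induction α with
  | inf C D hC hD => exact (List.mem_append.1 h).elim hC hD
  | neg C hC => exact hC h
  | _ => simp_all [base, head]

theorem mem_letters {α φ : ALC X R} (h : φ ∈ α.base) {l : X ⊕ R} (hl : φ.head = some l) :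
    l ∈ α.letters := by
  simp only [letters, List.mem_dedup, List.mem_filterMap]
  exact ⟨φ, h, hl⟩

theorem depth_le_of_mem_base {α φ : ALC X R} (h : φ ∈ α.base) : φ.depth ≤ α.depth := by
  induction α with
  | inf C D hC hD =>
    exact (List.mem_append.1 h).elim (fun h => (hC h).trans (le_max_left _ _))
      (fun h => (hD h).trans (le_max_right _ _))
  | neg C hC => exact hC h
  | _ => simp_all [base]

theorem depth_lt_of_mem_args {α C : ALC X R} (h : C ∈ α.args) : C.depth < α.depth := by
  obtain ⟨φ, hφ, hC⟩ := List.mem_filterMap.1 h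
  have := depth_le_of_mem_base hφ
  cases φ <;> simp_all [arg, depth]

theorem depth_pos_of_mem_letters {α : ALC X R} {ρ : R} (h : .inr ρ ∈ α.letters) :
    0 < α.depth := by
  simp only [letters, List.mem_dedup, List.mem_filterMap] at h
  obtain ⟨φ, hφ, hl⟩ := h
  have := depth_le_of_mem_base hφ
  cases φ <;> simp_all [head, depth]
  omega

/-- The Boolean combinations of `Cs` below `D`, each with the continuation `k` applied to the
valuation that records the truth values of the formulas `∃ρ.C` for `C` in `Cs`. -/
noncomputable def cells {Y : Type*} (k : (ALC X R → Prop) → Y) (ρ : R) :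
    List (ALC X R) → ALC X R → (ALC X R → Prop) → List (ALC X R × Y)
  | [], D, V => [(D, k V)]
  | C :: Cs, D, V => open Classical in
    cells k ρ Cs (.inf D C) (Function.update V (.ex ρ C) True) ++
      cells k ρ Cs (.inf D (.neg C)) (Function.update V (.ex ρ C) False)

/-- Flip the coins `φ` for all pairs `(C, φ)` in the list; then ask whether the `ρ`-successor
satisfies the disjunction of the `C` whose coin shows success, or `acc`. -/
def mix (tr : ALC X R → ADL X R) (ρ : R) : List (ALC X R × ADL X R) → ALC X R → ADL X R
  | [], acc => .cond (tr acc) .top ρ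
  | p :: l, acc => .ite p.2 (mix tr ρ l (acc.or p.1)) (mix tr ρ l acc)

/-- Decide the letters in the list one after the other, starting from the valuation `V`. -/
noncomputable def decisionTree (tr : ALC X R → ADL X R) (α : ALC X R) :
    List (X ⊕ R) → (ALC X R → Prop) → ADL X R
  | [], V => open Classical in if α.Holds V then .top else .bot
  | .inl A :: L, V => open Classical in
    .ite (.atom A) (decisionTree tr α L (Function.update V (.atom A) True))
      (decisionTree tr α L (Function.update V (.atom A) False))
  | .inr ρ :: L, V => mix tr ρ (cells (decisionTree tr α L) ρ α.args .top V) bot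

/-- Translation of formulas of modal depth less than `n`. -/
noncomputable def toADLAux : ℕ → ALC X R → ADL X R
  | 0, _ => .top
  | n + 1, α => decisionTree (toADLAux n) α α.letters fun _ => False

/-- The translation of ALC into ADL. -/
noncomputable def toADL (α : ALC X R) : ADL X R := toADLAux (α.depth + 1) α

theorem depth_cells {Y : Type*} (k : (ALC X R → Prop) → Y) (ρ : R) {n : ℕ} (Cs : List (ALC X R))
    (hCs : ∀ C ∈ Cs, C.depth < n) (D : ALC X R) (hD : D.depth < n) (V : ALC X R → Prop) :
    ∀ p ∈ cells k ρ Cs D V, p.1.depth < n := by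
  induction Cs generalizing D V with
  | nil => simpa [cells] using hD
  | cons C Cs ih =>
    have hC := hCs C (by simp)
    have hCs' : ∀ C ∈ Cs, C.depth < n := fun C h => hCs C (by simp [h])
    intro p hp
    rcases List.mem_append.1 hp with hp | hp
    · exact ih hCs' _ (by simp [depth, hC, hD]) _ p hp
    · exact ih hCs' _ (by simp [depth, hC, hD]) _ p hp

theorem sat_of_mem_cells {Y W : Type*} (M : Interp X R W) (w : W) (k : (ALC X R → Prop) → Y)
    (ρ : R) (Cs : List (ALC X R)) (D : ALC X R) (V : ALC X R → Prop) :
    ∀ p ∈ cells k ρ Cs D V, M.Sat p.1 w → M.Sat D w := by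
  induction Cs generalizing D V with
  | nil => simp [cells]
  | cons C Cs ih =>
    intro p hp h
    rcases List.mem_append.1 hp with hp | hp
    · exact (ih _ _ p hp h).1
    · exact (ih _ _ p hp h).1

theorem pairwise_cells {Y W : Type*} (k : (ALC X R → Prop) → Y)
    (ρ : R) (Cs : List (ALC X R)) (D : ALC X R) (V : ALC X R → Prop) :
    (cells k ρ Cs D V).Pairwise fun p q => ∀ (M : Interp X R W) (w : W),
      ¬ (M.Sat p.1 w ∧ M.Sat q.1 w) := by
  induction Cs generalizing D V with
  | nil => simp [cells]
  | cons C Cs ih =>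
    refine List.pairwise_append.2 ⟨ih _ _, ih _ _, fun p hp q hq M w h => ?_⟩
    exact (sat_of_mem_cells M w _ _ _ _ _ q hq h.2).2 (sat_of_mem_cells M w _ _ _ _ _ p hp h.1).2

end ALC

namespace Interp

variable {X R W : Type*} {M : Interp X R W}

theorem Functional.sat_ex_inf (hM : M.Functional) (ρ : R) (C D : ALC X R) (w : W) :
    M.Sat (.ex ρ (.inf C D)) w ↔ M.Sat (.ex ρ C) w ∧ M.Sat (.ex ρ D) w := by
  constructor
  · rintro ⟨j, hj, hC, hD⟩
    exact ⟨⟨j, hj, hC⟩, j, hj, hD⟩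
  · rintro ⟨⟨j, hj, hC⟩, j', hj', hD⟩
    obtain rfl := (hM ρ w).unique hj hj'
    exact ⟨j, hj, hC, hD⟩

theorem Functional.sat_ex_neg (hM : M.Functional) (ρ : R) (C : ALC X R) (w : W) :
    M.Sat (.ex ρ (.neg C)) w ↔ ¬ M.Sat (.ex ρ C) w := by
  constructor
  · rintro ⟨j, hj, hC⟩ ⟨j', hj', hC'⟩
    obtain rfl := (hM ρ w).unique hj hj'
    exact hC hC'
  · intro h
    obtain ⟨j, hj, -⟩ := hM ρ w
    exact ⟨j, hj, fun hC => h ⟨j, hj, hC⟩⟩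

theorem Functional.sat_ex_top (hM : M.Functional) (ρ : R) (w : W) : M.Sat (.ex ρ .top) w :=
  let ⟨j, hj, _⟩ := hM ρ w
  ⟨j, hj, trivial⟩

theorem Functional.sat_ex_or (hM : M.Functional) (ρ : R) (C D : ALC X R) (w : W) :
    M.Sat (.ex ρ (C.or D)) w ↔ M.Sat (.ex ρ C) w ∨ M.Sat (.ex ρ D) w := by
  rw [ALC.or, hM.sat_ex_neg, hM.sat_ex_inf, hM.sat_ex_neg, hM.sat_ex_neg, or_iff_not_and_not]

end Interp

theorem AleatoricStructure.eval_cond_top {X R I : Type*} (B : AleatoricStructure X R I)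
    (α : ADL X R) (ρ : R) (i : I) :
    B.eval (.cond α .top ρ) i = ∑' j, (B.role ρ i j).toReal * B.eval α j := by
  have h : ∑' j, (B.role ρ i j).toReal = 1 := by
    rw [← ENNReal.tsum_toReal_eq fun j => (B.role ρ i).apply_ne_top j, PMF.tsum_coe,
      ENNReal.toReal_one]
  simp [eval, h]

/-- A random functional interpretation `M` on a set `W` of worlds, each read as an individual
`last w` of `B`: the σ-algebras `F w l` carry the information about the atomic concept or role `l`
at the world `w`, they are independent, and the probabilities are those of `B`. -/
structure IsRandomReading {X R I W Ω : Type*} [MeasurableSpace Ω] (B : AleatoricStructure X R I)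
    (last : W → I) (P : Measure Ω) (M : Ω → Interp X R W)
    (F : W → X ⊕ R → MeasurableSpace Ω) : Prop where
  functional : ∀ ω, (M ω).Functional
  le : ∀ w l, F w l ≤ ‹MeasurableSpace Ω›
  measurable_atom : ∀ w A, MeasurableSet[F w (.inl A)] {ω | w ∈ (M ω).c A}
  measurable_ex : ∀ w ρ C, MeasurableSet[F w (.inr ρ)] {ω | (M ω).Sat (.ex ρ C) w}
  indep : ∀ w (L : Set (X ⊕ R)), ∀ l ∉ L, Indep (F w l) (⨆ k ∈ L, F w k) P
  prob_atom : ∀ w A, P.real {ω | w ∈ (M ω).c A} = B.lik (last w) A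
  prob_ex : ∀ ρ C (v : I → ℝ), (∀ w, P.real {ω | (M ω).Sat C w} = v (last w)) →
    ∀ w, P.real {ω | (M ω).Sat (.ex ρ C) w} = ∑' y, (B.role ρ (last w) y).toReal * v y

namespace IsRandomReading

open ALC

variable {X R I W Ω : Type*} [MeasurableSpace Ω] {B : AleatoricStructure X R I}
  {last : W → I} {P : Measure Ω} {M : Ω → Interp X R W}
  {F : W → X ⊕ R → MeasurableSpace Ω}

/-- The actual truth value of the formulas in `S`, and the prescribed one of the others. -/
def partialVal (M : Interp X R W) (w : W) (S : Set (ALC X R)) (V : ALC X R → Prop)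
    (φ : ALC X R) : Prop :=
  (φ ∈ S ∧ M.Sat φ w) ∨ (φ ∉ S ∧ V φ)

/-- The formulas governed by the letters in `L`. -/
def governed (L : Set (X ⊕ R)) : Set (ALC X R) := {φ | ∃ l ∈ L, φ.head = some l}

theorem partialVal_cons {M : Interp X R W} {w : W} {S T : Set (ALC X R)} {V : ALC X R → Prop}
    {φ : ALC X R} {b : Prop} [DecidableEq (ALC X R)] (hT : ∀ ψ, ψ ∈ T ↔ ψ = φ ∨ ψ ∈ S)
    (hb : M.Sat φ w ↔ b) :
    partialVal M w T V = partialVal M w S (Function.update V φ b) := by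
  funext ψ
  simp only [partialVal, hT, Function.update_apply]
  by_cases h : ψ = φ
  · subst h
    by_cases hS : ψ ∈ S <;> simp [hb, hS]
  · simp [h]

theorem measurable_holds (h : IsRandomReading B last P M F) (w : W) (L : Set (X ⊕ R))
    (V : ALC X R → Prop) (α : ALC X R) :
    MeasurableSet[⨆ l ∈ L, F w l]
      {ω | α.Holds (partialVal (M ω) w (governed L) V)} := by
  have key : ∀ (φ : ALC X R) (l : X ⊕ R), φ.head = some l →
      MeasurableSet[F w l] {ω | (M ω).Sat φ w} →
      MeasurableSet[⨆ l ∈ L, F w l] {ω | partialVal (M ω) w (governed L) V φ} := by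
    intro φ l hφ hm
    by_cases hl : l ∈ L
    · have hg : φ ∈ governed L := ⟨l, hl, hφ⟩
      simp only [partialVal, hg, true_and, not_true, false_and, or_false]
      exact le_iSup₂ (f := fun l (_ : l ∈ L) => F w l) l hl _ hm
    · have hg : φ ∉ governed L := by
        rintro ⟨l', hl', h'⟩
        rw [hφ] at h'
        cases h'
        exact hl hl'
      simp only [partialVal, hg, false_and, not_false_eq_true, true_and, false_or]
      exact @MeasurableSet.const _ (⨆ l ∈ L, F w l) _
  induction α with
  | top => exact @MeasurableSet.univ _ (⨆ l ∈ L, F w l)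
  | atom A => exact key _ _ rfl (h.measurable_atom w A)
  | inf C D hC hD => exact @MeasurableSet.inter _ (⨆ l ∈ L, F w l) _ _ hC hD
  | neg C hC => exact @MeasurableSet.compl _ _ (⨆ l ∈ L, F w l) hC
  | ex ρ C => exact key _ _ rfl (h.measurable_ex w ρ C)

theorem real_inter (h : IsRandomReading B last P M F) {w : W} {L : Set (X ⊕ R)} {l : X ⊕ R}
    (hl : l ∉ L) {s : Set Ω} (hs : MeasurableSet[F w l] s) (V : ALC X R → Prop) (α : ALC X R) :
    P.real (s ∩ {ω | α.Holds (partialVal (M ω) w (governed L) V)}) =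
      P.real s * P.real {ω | α.Holds (partialVal (M ω) w (governed L) V)} := by
  simp only [Measure.real, ← ENNReal.toReal_mul]
  rw [(Indep_iff _ _ _).1 (h.indep w L l hl) _ _ hs (h.measurable_holds w L V α)]

variable [IsProbabilityMeasure P]

theorem eval_mix (h : IsRandomReading B last P M F) (w : W) (ρ : R) (tr : ALC X R → ADL X R)
    {n : ℕ} (htr : ∀ D : ALC X R, D.depth < n →
      P.real {ω | (M ω).Sat (.ex ρ D) w} = B.eval (.cond (tr D) .top ρ) (last w))
    (l : List (ALC X R × ADL X R)) (hl : ∀ p ∈ l, p.1.depth < n)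
    (hd : l.Pairwise fun p q => ∀ (M : Interp X R W) (w : W), ¬ (M.Sat p.1 w ∧ M.Sat q.1 w))
    (acc : ALC X R) (hacc : acc.depth < n)
    (ha : ∀ p ∈ l, ∀ (M : Interp X R W) (w : W), ¬ (M.Sat acc w ∧ M.Sat p.1 w)) :
    B.eval (mix tr ρ l acc) (last w) = P.real {ω | (M ω).Sat (.ex ρ acc) w} +
      (l.map fun p => P.real {ω | (M ω).Sat (.ex ρ p.1) w} * B.eval p.2 (last w)).sum := by
  induction l generalizing acc with
  | nil => simp [mix, htr acc hacc]
  | cons p l ih =>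
    have hl' : ∀ p ∈ l, p.1.depth < n := fun q hq => hl q (by simp [hq])
    obtain ⟨hp, hd'⟩ := List.pairwise_cons.1 hd
    have hadd : P.real {ω | (M ω).Sat (.ex ρ (acc.or p.1)) w} =
        P.real {ω | (M ω).Sat (.ex ρ acc) w} + P.real {ω | (M ω).Sat (.ex ρ p.1) w} := by
      rw [← measureReal_union _ (h.le _ _ _ (h.measurable_ex w ρ p.1))]
      · congr 1
        ext ω
        exact (h.functional ω).sat_ex_or ρ acc p.1 w
      · rw [Set.disjoint_left]
        intro ω h1 h2
        obtain ⟨j, -, hj⟩ := ((h.functional ω).sat_ex_inf ρ acc p.1 w).2 ⟨h1, h2⟩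
        exact ha p (by simp) _ _ hj
    have e1 := ih hl' hd' (acc.or p.1) (by simp [ALC.or, depth, hacc, hl p]) (by
      rintro q hq M w ⟨h1, h2⟩
      by_cases hs : M.Sat acc w
      · exact ha q (by simp [hq]) M w ⟨hs, h2⟩
      · exact hp q hq M w ⟨not_not.1 fun h3 => h1 ⟨hs, h3⟩, h2⟩)
    have e2 := ih hl' hd' acc hacc fun q hq => ha q (by simp [hq])
    simp only [mix, AleatoricStructure.eval, List.map_cons, List.sum_cons]
    rw [e1, e2, hadd]
    ring

theorem sum_cells (h : IsRandomReading B last P M F) (w : W) (ρ : R) (α : ALC X R)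
    {L : Set (X ⊕ R)} (hρ : .inr ρ ∉ L) (k : (ALC X R → Prop) → ADL X R)
    (hk : ∀ V, B.eval (k V) (last w) =
      P.real {ω | α.Holds (partialVal (M ω) w (governed L) V)})
    (Cs : List (ALC X R)) (D : ALC X R) (V : ALC X R → Prop) :
    ((cells k ρ Cs D V).map fun p =>
        P.real {ω | (M ω).Sat (.ex ρ p.1) w} * B.eval p.2 (last w)).sum =
      P.real ({ω | (M ω).Sat (.ex ρ D) w} ∩ {ω | α.Holds
        (partialVal (M ω) w (governed L ∪ {φ | ∃ C ∈ Cs, φ = .ex ρ C}) V)}) := by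
  classical
  induction Cs generalizing D V with
  | nil => simp [cells, hk, h.real_inter hρ (h.measurable_ex w ρ D)]
  | cons C Cs ih =>
    have hT : ∀ ψ, ψ ∈ governed L ∪ {φ | ∃ C' ∈ C :: Cs, φ = .ex ρ C'} ↔
        ψ = .ex ρ C ∨ ψ ∈ governed L ∪ {φ | ∃ C' ∈ Cs, φ = .ex ρ C'} := by
      intro ψ
      simp only [Set.mem_union, Set.mem_ofPred_eq, List.mem_cons, exists_eq_or_imp]
      tauto
    rw [← measureReal_inter_add_sdiff (h := measure_ne_top _ _)
      (ht := h.le _ _ _ (h.measurable_ex w ρ C))]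
    simp only [cells, List.map_append, List.sum_append]
    congr 1
    · convert ih (.inf D C) (Function.update V (.ex ρ C) True) using 2
      ext ω
      by_cases hC : (M ω).Sat (.ex ρ C) w
      · simp only [Set.mem_inter_iff, Set.mem_ofPred_eq, (h.functional ω).sat_ex_inf,
          partialVal_cons hT (iff_true_intro hC), hC, and_true]
      · simp only [Set.mem_inter_iff, Set.mem_ofPred_eq, (h.functional ω).sat_ex_inf, hC,
          and_false, false_and]
    · convert ih (.inf D (.neg C)) (Function.update V (.ex ρ C) False) using 2
      ext ω
      by_cases hC : (M ω).Sat (.ex ρ C) w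
      · simp only [Set.mem_inter_iff, Set.mem_sdiff, Set.mem_ofPred_eq, hC, not_true,
          (h.functional ω).sat_ex_inf, (h.functional ω).sat_ex_neg, and_false, false_and]
      · simp only [Set.mem_inter_iff, Set.mem_sdiff, Set.mem_ofPred_eq, (h.functional ω).sat_ex_inf,
          (h.functional ω).sat_ex_neg, partialVal_cons hT (iff_false_intro hC), hC, and_true,
          not_false_eq_true]

theorem eval_decisionTree (h : IsRandomReading B last P M F) (w : W) (α : ALC X R)
    (tr : ALC X R → ADL X R) (htr : ∀ (ρ : R) (D : ALC X R), D.depth < α.depth →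
      P.real {ω | (M ω).Sat (.ex ρ D) w} = B.eval (.cond (tr D) .top ρ) (last w))
    (L : List (X ⊕ R)) (hL : L.Nodup) (hLα : ∀ l ∈ L, l ∈ α.letters) (V : ALC X R → Prop) :
    B.eval (decisionTree tr α L V) (last w) =
      P.real {ω | α.Holds (partialVal (M ω) w (governed {l | l ∈ L}) V)} := by
  classical
  induction L generalizing V with
  | nil =>
    have : ∀ ω, partialVal (M ω) w (governed {l | l ∈ []}) V = V := by
      intro ω
      funext φ
      simp [partialVal, governed]
    simp only [this, decisionTree]
    split_ifs with hV <;> simp [AleatoricStructure.eval, hV]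
  | cons l L ih =>
    obtain ⟨hl, hL'⟩ := List.nodup_cons.1 hL
    have ih := ih hL' fun l hl => hLα l (by simp [hl])
    cases l with
    | inl A =>
      have hT : ∀ ψ : ALC X R, ψ ∈ governed {l | l ∈ .inl A :: L} ↔
          ψ = .atom A ∨ ψ ∈ governed {l | l ∈ L} := by
        intro ψ
        cases ψ <;> simp [governed, head]
      have hA := h.measurable_atom w A
      have hA' := h.le _ _ _ hA
      have e1 := h.real_inter (L := {l | l ∈ L}) hl hA (Function.update V (.atom A) True) α
      have e2 := h.real_inter (L := {l | l ∈ L}) hl (@MeasurableSet.compl _ _ (F w _) hA)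
        (Function.update V (.atom A) False) α
      rw [measureReal_compl hA', probReal_univ, h.prob_atom] at e2
      rw [h.prob_atom] at e1
      simp only [decisionTree, AleatoricStructure.eval, ih]
      rw [← e1, ← e2, ← measureReal_inter_add_sdiff (h := measure_ne_top _ _) (ht := hA')
        (s := {ω | α.Holds (partialVal (M ω) w (governed {l | l ∈ .inl A :: L}) V)})]
      congr 2
      · ext ω
        by_cases hs : w ∈ (M ω).c A
        · have hs' : (M ω).Sat (.atom A) w := hs
          simp only [Set.mem_inter_iff, Set.mem_ofPred_eq, hs, true_and, and_true,
            partialVal_cons hT (iff_true_intro hs')]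
        · simp [hs]
      · ext ω
        by_cases hs : w ∈ (M ω).c A
        · simp [hs]
        · have hs' : ¬ (M ω).Sat (.atom A) w := hs
          simp only [Set.mem_inter_iff, Set.mem_sdiff, Set.mem_compl_iff, Set.mem_ofPred_eq, hs,
            not_false_eq_true, true_and, and_true, partialVal_cons hT (iff_false_intro hs')]
    | inr ρ =>
      have hpos := depth_pos_of_mem_letters (hLα (.inr ρ) (by simp))
      have hargs : ∀ C ∈ α.args, C.depth < α.depth := fun C => depth_lt_of_mem_args
      rw [decisionTree, h.eval_mix w ρ tr (htr ρ) _ (depth_cells _ ρ _ hargs .top hpos _)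
        (pairwise_cells _ ρ _ _ _) bot hpos
        (fun _ _ _ _ h => h.1 trivial), h.sum_cells w ρ α (L := {l | l ∈ L}) hl _ ih]
      have h0 : {ω | (M ω).Sat (.ex ρ bot) w} = ∅ := by
        ext ω
        simp only [bot, Set.mem_ofPred_eq, (h.functional ω).sat_ex_neg,
          (h.functional ω).sat_ex_top, not_true, Set.mem_empty_iff_false]
      have h1 : {ω | (M ω).Sat (.ex ρ .top) w} = Set.univ := by
        ext ω
        simp only [Set.mem_ofPred_eq, (h.functional ω).sat_ex_top, Set.mem_univ]
      rw [h0, h1, measureReal_empty, zero_add, Set.univ_inter]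
      congr 1
      ext ω
      refine holds_congr α fun φ hφ => ?_
      have : φ ∈ governed {l | l ∈ L} ∪ {φ | ∃ C ∈ α.args, φ = .ex ρ C} ↔
          φ ∈ governed {l | l ∈ .inr ρ :: L} := by
        cases φ with
        | ex σ C =>
          have : C ∈ α.args := List.mem_filterMap.2 ⟨_, hφ, rfl⟩
          simp only [Set.mem_union, Set.mem_ofPred_eq, governed, head, ALC.ex.injEq,
            List.mem_cons, Option.some.injEq]
          constructor
          · rintro (⟨l, hl, rfl⟩ | ⟨C', -, rfl, -⟩)
            · exact ⟨_, .inr hl, rfl⟩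
            · exact ⟨_, .inl rfl, rfl⟩
          · rintro ⟨l, hl | hl, rfl⟩
            · cases hl
              exact .inr ⟨C, this, rfl, rfl⟩
            · exact .inl ⟨_, hl, rfl⟩
        | _ => simp [governed, head]
      simp only [partialVal, this]

theorem eval_toADLAux (h : IsRandomReading B last P M F) (n : ℕ) (α : ALC X R)
    (hn : α.depth < n) (w : W) :
    P.real {ω | (M ω).Sat α w} = B.eval (toADLAux n α) (last w) := by
  induction n generalizing α w with
  | zero => omega
  | succ n ih =>
    rw [toADLAux, h.eval_decisionTree w α (toADLAux n) _ _
      (by classical exact List.nodup_dedup _) fun _ => id]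
    · congr 1
      ext ω
      rw [Set.mem_ofPred_eq, ← holds_sat]
      refine holds_congr α fun φ hφ => ?_
      obtain ⟨l, hl⟩ := exists_head_of_mem_base hφ
      have : φ ∈ governed {l | l ∈ α.letters} := ⟨l, mem_letters hφ hl, hl⟩
      simp [partialVal, this]
    · intro ρ D hD
      rw [B.eval_cond_top]
      exact h.prob_ex ρ D _ (ih D (by omega)) w

/-- The probability that a formula is satisfied is the value of its translation. -/
theorem eval_toADL (h : IsRandomReading B last P M F) (α : ALC X R) (w : W) :
    P.real {ω | (M ω).Sat α w} = B.eval α.toADL (last w) :=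
  h.eval_toADLAux _ α (Nat.lt_succ_self _) w

end IsRandomReading

/-- A functional interpretation is a random reading of itself as an aleatoric structure. -/
theorem Interp.Functional.isRandomReading {X R J : Type*} {M : Interp X R J}
    (hM : M.Functional) :
    IsRandomReading (M.toAleatoric hM) id (Measure.dirac ()) (fun _ => M) (fun _ _ => ⊤) where
  functional _ := hM
  le _ _ := le_rfl
  measurable_atom _ _ := trivial
  measurable_ex _ _ _ := trivial
  indep w L l hl := by
    refine (Indep_iff _ _ _).2 fun s t _ _ => ?_
    simp only [Measure.dirac_apply]
    by_cases h1 : () ∈ s <;> by_cases h2 : () ∈ t <;> simp [h1, h2]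
  prob_atom w A := by
    by_cases h : w ∈ M.c A <;> simp [h, toAleatoric]
  prob_ex ρ C v hv w := by
    obtain ⟨hj, hu⟩ := (hM ρ w).choose_spec
    set j := (hM ρ w).choose with hjdef
    have : M.Sat (.ex ρ C) w ↔ M.Sat C j :=
      ⟨fun ⟨k, hk, hC⟩ => hu k hk ▸ hC, fun hC => ⟨j, hj, hC⟩⟩
    simp only [this, hv, id]
    rw [tsum_eq_single j]
    · simp [toAleatoric, ← hjdef]
    · intro k hk
      simp [toAleatoric, ← hjdef, hk]

/-- The translation is a logical equivalence on functional interpretations. -/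
theorem Interp.Functional.sat_iff_eval_toADL {X R J : Type*} {M : Interp X R J}
    (hM : M.Functional) (α : ALC X R) (j : J) :
    M.Sat α j ↔ (M.toAleatoric hM).eval α.toADL j = 1 := by
  have := hM.isRandomReading.eval_toADL α j
  rw [id] at this
  rw [← this]
  by_cases h : M.Sat α j <;> simp [h]

/-- A family of independent random variables with given discrete laws, each of which takes
values in the support of its law everywhere. -/
theorem exists_independent_dice {ι E : Type*} [MeasurableSpace E] [DiscreteMeasurableSpace E]
    (p : ι → PMF E) :
    ∃ (P : Measure ((d : ι) → (p d).support)) (Z : ι → ((d : ι) → (p d).support) → E),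
      IsProbabilityMeasure P ∧ (∀ d, Measurable (Z d)) ∧ iIndepFun Z P ∧
      (∀ d ω, Z d ω ∈ (p d).support) ∧
      ∀ d (s : Set E), P (Z d ⁻¹' s) = (p d).toOuterMeasure s := by
  have hq : ∀ d, HasSum (fun x : (p d).support => p d x) 1 := fun d => by
    have := ENNReal.summable.hasSum (f := fun x : (p d).support => p d x)
    have h1 : ∑' x : (p d).support, p d x = 1 := by
      rw [← PMF.tsum_coe (p d)]
      exact tsum_subtype_support (p d)
    rwa [h1] at this
  let q : (d : ι) → PMF (p d).support := fun d => ⟨_, hq d⟩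
  have hmap : ∀ d, (q d).map Subtype.val = p d := by
    intro d
    ext b
    rw [PMF.map_apply]
    by_cases hb : b ∈ (p d).support
    · rw [tsum_eq_single ⟨b, hb⟩]
      · simp [q]
        rfl
      · intro c hc
        rw [if_neg fun h => hc (Subtype.ext h.symm)]
    · rw [(p d).apply_eq_zero_iff b |>.2 hb, ENNReal.tsum_eq_zero]
      intro c
      exact if_neg fun h : b = c => hb (h ▸ c.2)
  have hm : ∀ d, Measurable (Subtype.val : (p d).support → E) := fun d => measurable_subtype_coe
  refine ⟨Measure.infinitePi fun d => (q d).toMeasure, fun d ω => (ω d : E), inferInstance,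
    fun d => (hm d).comp (measurable_pi_apply d), iIndepFun_infinitePi hm, fun d ω => (ω d).2,
    fun d s => ?_⟩
  have hs : MeasurableSet (Subtype.val ⁻¹' s : Set (p d).support) :=
    hm d (MeasurableSet.of_discrete)
  have := (measurePreserving_eval_infinitePi (fun d => (q d).toMeasure) d).measure_preimage
    hs.nullMeasurableSet
  rw [PMF.toMeasure_apply_eq_toOuterMeasure_apply _ hs, ← PMF.toOuterMeasure_map_apply, hmap] at this
  exact this

namespace SampleWord

variable {R I : Type*}

/-- The word `v` starts with the word `w`. -/
inductive Extends (w : SampleWord R I) : SampleWord R I → Prop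
  | refl : Extends w w
  | step {v : SampleWord R I} (ρ : R) (y : I) : Extends w v → Extends w (v.step ρ y)

/-- The number of roles in a word. -/
def length : SampleWord R I → ℕ
  | .start => 0
  | .step w _ _ => w.length + 1

theorem Extends.length_le {w v : SampleWord R I} (h : w.Extends v) : w.length ≤ v.length := by
  induction h with
  | refl => exact le_rfl
  | step ρ y _ ih => exact ih.trans (Nat.le_succ _)

theorem Extends.of_step {w v : SampleWord R I} {ρ : R} {y : I} (h : (w.step ρ y).Extends v) :
    w.Extends v := by
  induction h with
  | refl => exact .step _ _ .refl
  | step ρ y _ ih => exact .step _ _ ih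

theorem not_extends_step (w : SampleWord R I) (ρ : R) (y : I) : ¬ (w.step ρ y).Extends w :=
  fun h => absurd h.length_le (by simp [length])

theorem Extends.eq_of_length_eq {w w' v : SampleWord R I} (h : w.Extends v) (h' : w'.Extends v)
    (hl : w.length = w'.length) : w = w' := by
  induction h with
  | refl =>
    cases h' with
    | refl => rfl
    | step ρ y h' =>
      have := h'.length_le
      simp only [length] at hl
      omega
  | step ρ y h ih =>
    cases h' with
    | refl =>
      have := h.length_le
      simp only [length] at hl
      omega
    | step _ _ h' => exact ih h'

/-- The dice that decide the formulas governed by the letter `l` at the word `w`. -/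
def dice {X : Type*} (w : SampleWord R I) (l : X ⊕ R) : Set (SampleWord R I × (X ⊕ R)) :=
  {d | d = (w, l) ∨ ∃ ρ y, l = .inr ρ ∧ (w.step ρ y).Extends d.1}

theorem disjoint_dice {X : Type*} (w : SampleWord R I) {l k : X ⊕ R} (h : l ≠ k) :
    Disjoint (w.dice l) (w.dice k) := by
  rw [Set.disjoint_left]
  rintro d (rfl | ⟨ρ, y, rfl, h1⟩) (h2 | ⟨σ, z, rfl, h2⟩)
  · exact h (congrArg Prod.snd h2)
  · exact not_extends_step _ _ _ h2
  · subst h2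
    exact not_extends_step _ _ _ h1
  · have := h1.eq_of_length_eq h2 rfl
    cases this
    exact h rfl

end SampleWord

/-- Satisfaction of a formula at a word is determined by the dice at the extensions of the word,
provided that every role has only countably many possible outcomes. -/
theorem measurableSet_sat {X R I Ω : Type*} [MeasurableSpace Ω]
    {M : Ω → Interp X R (SampleWord R I)} {S : SampleWord R I → R → Set I}
    (hS : ∀ w ρ, (S w ρ).Countable)
    (hM : ∀ ω ρ w w', (w, w') ∈ (M ω).r ρ → ∃ y ∈ S w ρ, w' = w.step ρ y)
    (C : ALC X R) (w : SampleWord R I)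
    (hc : ∀ v, w.Extends v → ∀ A, MeasurableSet {ω | v ∈ (M ω).c A})
    (hr : ∀ v, w.Extends v → ∀ ρ y, MeasurableSet {ω | (v, v.step ρ y) ∈ (M ω).r ρ}) :
    MeasurableSet {ω | (M ω).Sat C w} := by
  induction C generalizing w with
  | top => exact MeasurableSet.univ
  | atom A => exact hc w .refl A
  | inf C D hC hD => exact (hC w hc hr).inter (hD w hc hr)
  | neg C hC => exact (hC w hc hr).compl
  | ex ρ C hC =>
    have : {ω | (M ω).Sat (.ex ρ C) w} = ⋃ y ∈ S w ρ,
        {ω | (w, w.step ρ y) ∈ (M ω).r ρ} ∩ {ω | (M ω).Sat C (w.step ρ y)} := by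
      ext ω
      simp only [Interp.Sat, Set.mem_ofPred_eq, Set.mem_iUnion, Set.mem_inter_iff, exists_prop]
      constructor
      · rintro ⟨v, hv, h⟩
        obtain ⟨y, hy, rfl⟩ := hM _ _ _ _ hv
        exact ⟨y, hy, hv, h⟩
      · rintro ⟨y, -, hv, h⟩
        exact ⟨_, hv, h⟩
    rw [this]
    exact .biUnion (hS w ρ) fun y _ => (hr w .refl ρ y).inter
      (hC _ (fun v hv => hc v hv.of_step) fun v hv => hr v hv.of_step)

/-- The distribution of a coin. -/
noncomputable def PMF.coin (p : unitInterval) : PMF Bool :=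
  .ofFintype (fun b => ENNReal.ofReal (if b then p else 1 - p)) (by
    simp [← ENNReal.ofReal_add p.2.1 (sub_nonneg.2 p.2.2)])

theorem PMF.toReal_coin (p : unitInterval) (b : Bool) :
    (PMF.coin p b).toReal = if b then (p : ℝ) else 1 - p := by
  have h0 := p.2.1
  have h1 := sub_nonneg.2 p.2.2
  cases b <;> simp [coin, h0, h1]

namespace AleatoricStructure

variable {X R I : Type*}

/-- The law of the die of a letter at an individual: the die of an atomic concept shows a truth
value and that of a role an individual. -/
noncomputable def die (B : AleatoricStructure X R I) (x : I) : X ⊕ R → PMF (Bool × I)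
  | .inl A => (PMF.coin (B.lik x A)).map fun b => (b, x)
  | .inr ρ => (B.role ρ x).map fun y => (true, y)

theorem die_inl (B : AleatoricStructure X R I) (x : I) (A : X) (b : Bool) :
    ((B.die x (.inl A)).toOuterMeasure {e | e.1 = b}).toReal =
      if b then (B.lik x A : ℝ) else 1 - B.lik x A := by
  rw [die, PMF.toOuterMeasure_map_apply, ← PMF.toReal_coin,
    ← PMF.toOuterMeasure_apply_singleton]
  rfl

theorem die_inr (B : AleatoricStructure X R I) (x : I) (ρ : R) (y : I) :
    (B.die x (.inr ρ)).toOuterMeasure {e | e.2 = y} = B.role ρ x y := by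
  rw [die, PMF.toOuterMeasure_map_apply, ← PMF.toOuterMeasure_apply_singleton]
  rfl

theorem lik_pos_of_mem_die {B : AleatoricStructure X R I} {x : I} {A : X} {e : Bool × I}
    (he : e ∈ (B.die x (.inl A)).support) (h : e.1 = true) : 0 < (B.lik x A : ℝ) := by
  obtain ⟨b, hb, rfl⟩ := (PMF.mem_support_map_iff _ _ _).1 he
  obtain rfl : b = true := h
  have h0 := ENNReal.toReal_pos ((PMF.mem_support_iff _ _).1 hb) (PMF.apply_ne_top _ _)
  simpa [PMF.toReal_coin] using h0

theorem mem_support_of_mem_die {B : AleatoricStructure X R I} {x : I} {ρ : R} {e : Bool × I}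
    (he : e ∈ (B.die x (.inr ρ)).support) : e.2 ∈ (B.role ρ x).support := by
  obtain ⟨y, hy, rfl⟩ := (PMF.mem_support_map_iff _ _ _).1 he
  exact hy

/-- The interpretation given by the outcomes of all dice. -/
def rolled (f : SampleWord R I × (X ⊕ R) → Bool × I) : Interp X R (SampleWord R I) where
  c A := {w | (f (w, .inl A)).1 = true}
  r ρ := {p | p.2 = p.1.step ρ (f (p.1, .inr ρ)).2}

theorem mem_rolled {f : SampleWord R I × (X ⊕ R) → Bool × I} {w v : SampleWord R I} {ρ : R} :
    (w, v) ∈ (rolled f).r ρ ↔ v = w.step ρ (f (w, .inr ρ)).2 :=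
  Iff.rfl

theorem rolled_functional (f : SampleWord R I × (X ⊕ R) → Bool × I) : (rolled f).Functional :=
  fun ρ w => ⟨w.step ρ (f (w, .inr ρ)).2, mem_rolled.2 rfl, fun _ h => mem_rolled.1 h⟩

theorem step_mem_rolled {f : SampleWord R I × (X ⊕ R) → Bool × I} {w : SampleWord R I} {ρ : R}
    {y : I} : (w, w.step ρ y) ∈ (rolled f).r ρ ↔ (f (w, .inr ρ)).2 = y := by
  rw [mem_rolled]
  simp only [SampleWord.step.injEq, true_and]
  exact eq_comm

section Dice

variable {Ω : Type*} {mΩ : MeasurableSpace Ω} {B : AleatoricStructure X R I} {i : I}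
  {P : Measure Ω} {mE : MeasurableSpace (Bool × I)}
  {Z : SampleWord R I × (X ⊕ R) → Ω → Bool × I}

theorem rolled_isSampling (hZ : ∀ d ω, Z d ω ∈ (B.die (d.1.last i) d.2).support) (ω : Ω) :
    B.IsSampling i (rolled fun d => Z d ω) where
  functional := rolled_functional _
  role_succ ρ w _ h :=
    ⟨_, h, (PMF.apply_pos_iff _ _).2 (mem_support_of_mem_die (hZ (w, .inr ρ) ω))⟩
  concept A w h := lik_pos_of_mem_die (hZ (w, .inl A) ω) h

/-- The information carried by a set of dice. -/
abbrev diceAlgebra (mE : MeasurableSpace (Bool × I)) (Z : SampleWord R I × (X ⊕ R) → Ω → Bool × I)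
    (S : Set (SampleWord R I × (X ⊕ R))) : MeasurableSpace Ω :=
  ⨆ d ∈ S, mE.comap (Z d)

theorem diceAlgebra_mono {S T : Set (SampleWord R I × (X ⊕ R))} (h : S ⊆ T) :
    diceAlgebra mE Z S ≤ diceAlgebra mE Z T :=
  biSup_mono h

theorem diceAlgebra_le (hm : ∀ d, Measurable (Z d)) (S : Set (SampleWord R I × (X ⊕ R))) :
    diceAlgebra mE Z S ≤ mΩ :=
  iSup₂_le fun d _ => (hm d).comap_le

theorem indep_diceAlgebra (hm : ∀ d, Measurable (Z d)) (hi : iIndepFun Z P)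
    {S T : Set (SampleWord R I × (X ⊕ R))} (h : Disjoint S T) :
    Indep (diceAlgebra mE Z S) (diceAlgebra mE Z T) P :=
  indep_iSup_of_disjoint (fun d => (hm d).comap_le) hi.iIndep h

variable [DiscreteMeasurableSpace (Bool × I)]

theorem measurableSet_preimage_die {S : Set (SampleWord R I × (X ⊕ R))}
    {d : SampleWord R I × (X ⊕ R)} (hd : d ∈ S) (s : Set (Bool × I)) :
    MeasurableSet[diceAlgebra mE Z S] (Z d ⁻¹' s) :=
  le_iSup₂ (f := fun d (_ : d ∈ S) => mE.comap (Z d)) d hd _ ⟨s, .of_discrete, rfl⟩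

theorem measurableSet_sat_rolled (hZ : ∀ d ω, Z d ω ∈ (B.die (d.1.last i) d.2).support)
    (C : ALC X R) (w : SampleWord R I) {S : Set (SampleWord R I × (X ⊕ R))}
    (hS : ∀ d : SampleWord R I × (X ⊕ R), w.Extends d.1 → d ∈ S) :
    MeasurableSet[diceAlgebra mE Z S] {ω | (rolled fun d => Z d ω).Sat C w} := by
  refine @measurableSet_sat _ _ _ _ (diceAlgebra mE Z S) _
    (fun w ρ => (B.role ρ (w.last i)).support) (fun w ρ => PMF.support_countable _) ?_ C w ?_ ?_
  · intro ω ρ w w' h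
    exact ⟨_, mem_support_of_mem_die (hZ (w, .inr ρ) ω), h⟩
  · intro v hv A
    exact measurableSet_preimage_die (d := (v, .inl A)) (hS _ hv) {e | e.1 = true}
  · intro v hv ρ y
    simp only [step_mem_rolled]
    exact measurableSet_preimage_die (d := (v, .inr ρ)) (hS _ hv) {e | e.2 = y}

theorem sat_ex_rolled (hZ : ∀ d ω, Z d ω ∈ (B.die (d.1.last i) d.2).support)
    (ρ : R) (C : ALC X R) (w : SampleWord R I) :
    {ω | (rolled fun d => Z d ω).Sat (.ex ρ C) w} = ⋃ y ∈ (B.role ρ (w.last i)).support,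
      Z (w, .inr ρ) ⁻¹' {e | e.2 = y} ∩ {ω | (rolled fun d => Z d ω).Sat C (w.step ρ y)} := by
  ext ω
  simp only [Interp.Sat, Set.mem_ofPred_eq, Set.mem_iUnion, Set.mem_inter_iff, exists_prop,
    Set.mem_preimage]
  constructor
  · rintro ⟨v, hv, h⟩
    obtain rfl := mem_rolled.1 hv
    exact ⟨_, mem_support_of_mem_die (hZ (w, .inr ρ) ω), rfl, h⟩
  · rintro ⟨y, -, hy, h⟩
    exact ⟨_, step_mem_rolled.2 hy, h⟩

theorem measure_preimage_inter_sat (hZ : ∀ d ω, Z d ω ∈ (B.die (d.1.last i) d.2).support)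
    (hm : ∀ d, Measurable (Z d)) (hi : iIndepFun Z P)
    (hP : ∀ d s, P (Z d ⁻¹' s) = (B.die (d.1.last i) d.2).toOuterMeasure s)
    (ρ : R) (C : ALC X R) (w : SampleWord R I) (y : I) :
    P (Z (w, .inr ρ) ⁻¹' {e | e.2 = y} ∩
        {ω | (rolled fun d => Z d ω).Sat C (w.step ρ y)}) =
      B.role ρ (w.last i) y * P {ω | (rolled fun d => Z d ω).Sat C (w.step ρ y)} := by
  have hd : Disjoint ({(w, .inr ρ)} : Set (SampleWord R I × (X ⊕ R)))
      {d | (w.step ρ y).Extends d.1} := by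
    rw [Set.disjoint_singleton_left]
    exact SampleWord.not_extends_step w ρ y
  have := (Indep_iff _ _ _).1 (indep_diceAlgebra hm hi hd) (Z (w, .inr ρ) ⁻¹' {e | e.2 = y})
    {ω | (rolled fun d => Z d ω).Sat C (w.step ρ y)}
    (measurableSet_preimage_die (Set.mem_singleton _) _)
    (measurableSet_sat_rolled hZ C _ fun _ hd => hd)
  rw [this, hP]
  congr 1
  exact die_inr B _ ρ y

theorem prob_ex_rolled [IsProbabilityMeasure P]
    (hZ : ∀ d ω, Z d ω ∈ (B.die (d.1.last i) d.2).support)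
    (hm : ∀ d, Measurable (Z d)) (hi : iIndepFun Z P)
    (hP : ∀ d s, P (Z d ⁻¹' s) = (B.die (d.1.last i) d.2).toOuterMeasure s)
    (ρ : R) (C : ALC X R) (v : I → ℝ)
    (hv : ∀ w : SampleWord R I, P.real {ω | (rolled fun d => Z d ω).Sat C w} = v (w.last i))
    (w : SampleWord R I) :
    P.real {ω | (rolled fun d => Z d ω).Sat (.ex ρ C) w} =
      ∑' y, (B.role ρ (w.last i) y).toReal * v y := by
  have hC : ∀ y, MeasurableSet {ω | (rolled fun d => Z d ω).Sat C (w.step ρ y)} := fun y =>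
    diceAlgebra_le hm _ _ (measurableSet_sat_rolled (S := Set.univ) hZ C _ fun _ _ => trivial)
  rw [sat_ex_rolled hZ, Measure.real, measure_biUnion (PMF.support_countable _)]
  · simp only [measure_preimage_inter_sat hZ hm hi hP]
    rw [tsum_subtype (B.role ρ (w.last i)).support fun y => B.role ρ (w.last i) y *
        P {ω | (rolled fun d => Z d ω).Sat C (w.step ρ y)},
      ENNReal.tsum_toReal_eq]
    · refine tsum_congr fun y => ?_
      have hy : P.real {ω | (rolled fun d => Z d ω).Sat C (w.step ρ y)} = v y := hv _
      by_cases h : y ∈ (B.role ρ (w.last i)).support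
      · rw [Set.indicator_of_mem h, ENNReal.toReal_mul, ← hy, Measure.real]
      · rw [Set.indicator_of_notMem h, (PMF.apply_eq_zero_iff _ _).2 h]
        simp
    · intro y
      refine ne_top_of_le_ne_top (ENNReal.mul_ne_top (PMF.apply_ne_top _ y) (measure_ne_top P _))
        (Set.indicator_le_self _ _ y)
  · intro y _ z _ hyz
    refine Set.disjoint_left.2 fun ω h1 h2 => hyz ?_
    exact h1.1.symm.trans h2.1
  · intro y _
    exact (hm _ .of_discrete).inter (hC y)

theorem isRandomReading_rolled [IsProbabilityMeasure P]
    (hZ : ∀ d ω, Z d ω ∈ (B.die (d.1.last i) d.2).support)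
    (hm : ∀ d, Measurable (Z d)) (hi : iIndepFun Z P)
    (hP : ∀ d s, P (Z d ⁻¹' s) = (B.die (d.1.last i) d.2).toOuterMeasure s) :
    IsRandomReading B (SampleWord.last i) P (fun ω => rolled fun d => Z d ω)
      (fun w l => diceAlgebra mE Z (w.dice l)) where
  functional _ := rolled_functional _
  le w l := diceAlgebra_le hm _
  measurable_atom w A :=
    measurableSet_preimage_die (d := (w, .inl A)) (.inl rfl) {e | e.1 = true}
  measurable_ex w ρ C := by
    rw [sat_ex_rolled hZ]
    exact @MeasurableSet.biUnion _ _ (diceAlgebra mE Z (w.dice (.inr ρ))) _ _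
      (PMF.support_countable _) fun y _ =>
        @MeasurableSet.inter _ (diceAlgebra mE Z (w.dice (.inr ρ))) _ _
          (measurableSet_preimage_die (.inl rfl) _)
          (measurableSet_sat_rolled hZ _ _ fun d hd => .inr ⟨ρ, y, rfl, hd⟩)
  indep w L l hl := by
    refine indep_of_indep_of_le_right (indep_diceAlgebra hm hi
      (T := ⋃ k ∈ L, w.dice k) ?_) (iSup₂_le fun k hk => diceAlgebra_mono
        (Set.subset_biUnion_of_mem (u := fun k => w.dice k) hk))
    simp only [Set.disjoint_iUnion_right]
    exact fun k hk => SampleWord.disjoint_dice w fun h => hl (h ▸ hk)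
  prob_atom w A := by
    have := B.die_inl (w.last i) A true
    rw [← hP (w, .inl A), if_pos rfl] at this
    exact this
  prob_ex := prob_ex_rolled hZ hm hi hP

theorem real_cylinder_rolled
    (hi : iIndepFun Z P)
    (hP : ∀ d s, P (Z d ⁻¹' s) = (B.die (d.1.last i) d.2).toOuterMeasure s)
    (s : Finset (SampleWord R I × X)) (b : SampleWord R I × X → Bool)
    (t : Finset (SampleWord R I × R)) (y : SampleWord R I × R → I) :
    P.real {ω | (∀ d ∈ s, d.1 ∈ (rolled fun d => Z d ω).c d.2 ↔ b d = true) ∧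
        ∀ d ∈ t, (d.1, d.1.step d.2 (y d)) ∈ (rolled fun d => Z d ω).r d.2} =
      (∏ d ∈ s, if b d then (B.lik (d.1.last i) d.2 : ℝ) else 1 - B.lik (d.1.last i) d.2) *
      ∏ d ∈ t, (B.role d.2 (d.1.last i) (y d)).toReal := by
  let e : SampleWord R I × X ⊕ SampleWord R I × R → SampleWord R I × (X ⊕ R) :=
    Sum.elim (fun d => (d.1, .inl d.2)) (fun d => (d.1, .inr d.2))
  have he : Function.Injective e := by
    rintro (⟨w, A⟩ | ⟨w, ρ⟩) (⟨w', A'⟩ | ⟨w', ρ'⟩) h <;> simp_all [e]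
  let T : SampleWord R I × X ⊕ SampleWord R I × R → Set (Bool × I) :=
    Sum.elim (fun d => {x | x.1 = b d}) (fun d => {x | x.2 = y d})
  have h := (hi.precomp he).measure_inter_preimage_eq_mul (s.disjSum t) (sets := T)
    fun _ _ => .of_discrete
  rw [Finset.prod_disjSum] at h
  have hset : {ω | (∀ d ∈ s, d.1 ∈ (rolled fun d => Z d ω).c d.2 ↔ b d = true) ∧
        ∀ d ∈ t, (d.1, d.1.step d.2 (y d)) ∈ (rolled fun d => Z d ω).r d.2} =
      ⋂ d ∈ s.disjSum t, Z (e d) ⁻¹' T d := by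
    ext ω
    simp only [step_mem_rolled]
    simp [rolled, e, T, Bool.coe_iff_coe]
  rw [hset, Measure.real, h, ENNReal.toReal_mul, ENNReal.toReal_prod, ENNReal.toReal_prod]
  congr 1
  · refine Finset.prod_congr rfl fun d _ => ?_
    rw [← die_inl, ← hP (d.1, .inl d.2)]
    rfl
  · refine Finset.prod_congr rfl fun d _ => ?_
    rw [← die_inr, ← hP (d.1, .inr d.2)]
    rfl

end Dice

theorem measurableSet_hat (B : AleatoricStructure X R I) (i : I) (β : ALC X R) :
    MeasurableSet (B.hat i β) :=
  measurableSet_sat (M := fun M : B.Sampling i => M.1)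
    (S := fun w ρ => (B.role ρ (w.last i)).support) (fun _ _ => PMF.support_countable _)
    (fun M ρ w _ h =>
      let ⟨y, hw, hy⟩ := M.2.role_succ ρ w _ h
      ⟨y, (PMF.apply_pos_iff _ _).1 hy, hw⟩) β .start
    (fun v _ A => MeasurableSpace.measurableSet_generateFrom (.inl ⟨v, A, rfl⟩))
    fun v _ ρ y => MeasurableSpace.measurableSet_generateFrom (.inr ⟨v, ρ, y, rfl⟩)

theorem measurableSet_cylinder (B : AleatoricStructure X R I) (i : I)
    (s : Finset (SampleWord R I × X)) (b : SampleWord R I × X → Bool)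
    (t : Finset (SampleWord R I × R)) (y : SampleWord R I × R → I) :
    MeasurableSet (B.cylinder i s b t y) := by
  have hc : ∀ d : SampleWord R I × X, MeasurableSet {M : B.Sampling i | d.1 ∈ M.1.c d.2} :=
    fun d => MeasurableSpace.measurableSet_generateFrom (.inl ⟨d.1, d.2, rfl⟩)
  have hr : ∀ d : SampleWord R I × R,
      MeasurableSet {M : B.Sampling i | (d.1, d.1.step d.2 (y d)) ∈ M.1.r d.2} :=
    fun d => MeasurableSpace.measurableSet_generateFrom (.inr ⟨d.1, d.2, y d, rfl⟩)
  have : B.cylinder i s b t y =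
      (⋂ d ∈ s, {M : B.Sampling i | d.1 ∈ M.1.c d.2 ↔ b d = true}) ∩
      ⋂ d ∈ t, {M : B.Sampling i | (d.1, d.1.step d.2 (y d)) ∈ M.1.r d.2} := by
    ext M
    simp [cylinder]
  rw [this]
  exact (s.measurableSet_biInter fun d _ => (hc d).iff (.const (b d = true))).inter
    (t.measurableSet_biInter fun d _ => hr d)

/-- The law of independent rolls of all dice exists, and the probability that a sampling satisfies
a formula is the value of its translation. -/
theorem exists_isSamplingLaw (B : AleatoricStructure X R I) (i : I) :
    ∃ P : Measure (B.Sampling i), IsProbabilityMeasure P ∧ B.IsSamplingLaw i P ∧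
      ∀ α : ALC X R, P.real (B.hat i α) = B.eval α.toADL i := by
  let mE : MeasurableSpace (Bool × I) := ⊤
  have : DiscreteMeasurableSpace (Bool × I) := ⟨fun _ => trivial⟩
  obtain ⟨P, Z, _, hm, hi, hZ, hP⟩ := exists_independent_dice
    fun d : SampleWord R I × (X ⊕ R) => B.die (d.1.last i) d.2
  let Φ : ((d : SampleWord R I × (X ⊕ R)) → (B.die (d.1.last i) d.2).support) → B.Sampling i :=
    fun ω => ⟨rolled fun d => Z d ω, rolled_isSampling hZ ω⟩
  have hΦ : Measurable Φ := by
    refine measurable_generateFrom ?_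
    rintro _ (⟨w, A, rfl⟩ | ⟨w, ρ, y, rfl⟩)
    · exact hm (w, .inl A) (.of_discrete (s := {e | e.1 = true}))
    · have : Φ ⁻¹' {M | (w, w.step ρ y) ∈ M.1.r ρ} = Z (w, .inr ρ) ⁻¹' {e | e.2 = y} := by
        ext ω
        exact step_mem_rolled (f := fun d => Z d ω)
      rw [this]
      exact hm _ .of_discrete
  refine ⟨P.map Φ, Measure.isProbabilityMeasure_map hΦ.aemeasurable, fun s b t y => ?_,
    fun α => ?_⟩
  · rw [map_measureReal_apply hΦ (B.measurableSet_cylinder i s b t y)]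
    exact real_cylinder_rolled hi hP s b t y
  · rw [map_measureReal_apply hΦ (B.measurableSet_hat i α)]
    exact (isRandomReading_rolled hZ hm hi hP).eval_toADL α .start

end AleatoricStructure

theorem mainTheorem2 {X R : Type*} (idr : R) :
    ∃ star : ALC X R → ADL X R,
      (∀ (α : ALC X R) {J : Type*} (M : Interp X R J) (hM : M.Functional) (j : J),
        M.Sat α j ↔ (M.toAleatoric hM).eval (star α) j = 1) ∧
      ∀ {I : Type*} (B : BeliefModel X R idr I) (i : I),
        ∃ P : Measure (B.Sampling i),
          IsProbabilityMeasure P ∧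
          B.IsSamplingLaw i P ∧
          (∀ β : ALC X R, MeasurableSet (B.hat i β)) ∧
          ∀ α : ALC X R, P.real (B.hat i α) = B.eval (star α) i := by
  refine ⟨ALC.toADL, fun α _ _ hM j => hM.sat_iff_eval_toADL α j, fun B i => ?_⟩
  obtain ⟨P, h1, h2, h3⟩ := B.exists_isSamplingLaw i
  exact ⟨P, h1, h2, B.measurableSet_hat i, h3⟩
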